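/- Let $\mathcal H$ be a finite-dimensional complex Hilbert space, $H$ a self-adjoint operator and $L_1,\dots,L_p$ arbitrary operators on $\mathcal H$, and let $\mathcal T_t=e^{t\mathcal L}$, $t\ge 0$, be the quantum dynamical semigroup with generator $$\mathcal L[\rho]=-i[H,\rho]+\sum_{k=1}^p\Big(L_k\rho L_k^\dagger-\tfrac12\{L_k^\dagger L_k,\rho\}\Big).$$ For a subspace $\mathcal H_S\subseteq\mathcal H$ let $\mathfrak I_S$ be the set of density operators (positive semidefinite, trace one) supported in $\mathcal H_S$. The subspace $\mathcal H_S$ is *invariant* if $\mathcal T_t(\mathfrak I_S)\subseteq\mathfrak I_S$ for all $t\ge0$, and *globally asymptotically stable* (GAS) if it is invariant and $\lim_{t\to\infty}\inf_{\tau\in\mathfrak I_S}\|\mathcal T_t(\rho)-\tau\|=0$ for every density operator $\rho$ (with $\inf\emptyset=\infty$). For an orthogonal decomposition $\mathcal H=\mathcal H_S^{(j)}\oplus\mathcal H_R^{(j)}$ write an operator $X$ in blocks $X=\begin{bmatrix}X_S^{(j)}&X_P^{(j)}\\X_Q^{(j)}&X_R^{(j)}\end{bmatrix}$. For an invariant subspace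 $\mathcal H_S$, the *dissipation-induced decomposition algorithm* starts from $\mathcal H_S^{(0)}=\mathcal H_S$, $\mathcal H_R^{(0)}=\mathcal H_S^\perp$ and performs, for $j=0,1,2,\dots$, the following iteration. Put $\mathcal K=\bigcap_k\ker L_{P,k}^{(j)}\subseteq\mathcal H_R^{(j)}$. - (a) If $\mathcal K=\{0\}$, set $\mathcal H_T^{(j+1)}=\mathcal H_R^{(j)}$ and stop: the algorithm is successfully completed. - (b) Otherwise, if $\mathcal K\subsetneq\mathcal H_R^{(j)}$, set $\mathcal H_R^{(j+1)}=\mathcal K$. - (c) Otherwise ($\mathcal K=\mathcal H_R^{(j)}\neq\{0\}$) let $\tilde{\mathcal L}_P^{(j)}=-iH_P^{(j)}-\frac12\sum_kL_{Q,k}^{(j)\dagger}L_{R,k}^{(j)}$. If $\tilde{\mathcal L}_P^{(j)}=0$, stop without success. If $\tilde{\mathcal L}_P^{(j)}\ne0$ and $\ker\tilde{\mathcal L}_P^{(j)}=\{0\}$, set $\mathcal H_T^{(j+1)}=\mathcal H_R^{(j)}$ and stop: the algorithm is successfully completed. Otherwise set $\mathcal H_R^{(j+1)}=\ker\tilde{\mathcal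 L}_P^{(j)}$. If the algorithm has not stopped, set $\mathcal H_T^{(j+1)}=\mathcal H_R^{(j)}\ominus\mathcal H_R^{(j+1)}$ and $\mathcal H_S^{(j+1)}=\mathcal H_S^{(j)}\oplus\mathcal H_T^{(j+1)}$, and continue with $j+1$. **Proposition.** Let $\mathcal H_S$ be an invariant subspace. The algorithm stops after finitely many iterations, and it is successfully completed if and only if $\mathcal H_S$ is GAS. If it is successfully completed after $q$ iterations, then $\mathcal H=\mathcal H_S\oplus\mathcal H_T^{(1)}\oplus\dots\oplus\mathcal H_T^{(q)}$ is an orthogonal direct sum. -/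

import Mathlib

open scoped Topology

noncomputable section

namespace DID

variable {E : Type*} [NormedAddCommGroup E] [InnerProductSpace ℂ E] [CompleteSpace E]
  [FiniteDimensional ℂ E] {p : ℕ}

/-- The Lindblad generator (with `ℏ = 1`)
`ρ ↦ -i [H, ρ] + ∑ k, (L k ρ (L k)† - ½ {(L k)† (L k), ρ})`,
as a linear map on the operators of the finite-dimensional Hilbert space `E`. -/
def lindbladLin (H : E →L[ℂ] E) (L : Fin p → E →L[ℂ] E) :
    (E →L[ℂ] E) →ₗ[ℂ] (E →L[ℂ] E) where
  toFun ρ := -(Complex.I • (H * ρ - ρ * H)) +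
    ∑ k, (L k * ρ * (L k).adjoint
      - (1 / 2 : ℂ) • ((L k).adjoint * L k * ρ + ρ * ((L k).adjoint * L k)))
  map_add' ρ σ := by
    rw [add_add_add_comm, ← Finset.sum_add_distrib]
    congr 1
    · simp only [mul_add, add_mul, smul_sub, smul_add]; abel
    · refine Finset.sum_congr rfl fun k _ => ?_
      simp only [mul_add, add_mul, smul_add]; abel
  map_smul' c ρ := by
    simp only [mul_smul_comm, smul_mul_assoc, RingHom.id_apply, smul_add, Finset.smul_sum,
      smul_sub, smul_neg, smul_comm c]

/-- The generator as a bounded operator (every linear map is continuous here). -/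
def lindblad (H : E →L[ℂ] E) (L : Fin p → E →L[ℂ] E) :
    (E →L[ℂ] E) →L[ℂ] (E →L[ℂ] E) :=
  LinearMap.toContinuousLinearMap (lindbladLin H L)

/-- The quantum dynamical semigroup `𝒯 t = exp (t 𝓛)` generated by `H` and `L`. -/
def semigroup (H : E →L[ℂ] E) (L : Fin p → E →L[ℂ] E) (t : ℝ) :
    (E →L[ℂ] E) →L[ℂ] (E →L[ℂ] E) :=
  NormedSpace.exp ((t : ℂ) • lindblad H L)

variable (E) in
/-- The states: positive semidefinite operators of trace one. -/
def densityOperators : Set (E →L[ℂ] E) :=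
  {ρ | ρ.IsPositive ∧ LinearMap.trace ℂ E (ρ : E →ₗ[ℂ] E) = 1}

/-- The states supported in `S`: in the decomposition `E = S ⊕ Sᗮ` only their `S`-`S` block is
nonzero, that is `ρ = Π ρ Π` for the orthogonal projection `Π` onto `S`. -/
def statesOn (S : Submodule ℂ E) : Set (E →L[ℂ] E) :=
  {ρ | ρ ∈ densityOperators E ∧ S.starProjection * ρ * S.starProjection = ρ}

/-- `S` is invariant: trajectories starting in `statesOn S` stay there at all positive times. -/
def IsInvariant (H : E →L[ℂ] E) (L : Fin p → E →L[ℂ] E) (S : Submodule ℂ E) : Prop :=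
  ∀ ρ ∈ statesOn S, ∀ t : ℝ, 0 ≤ t → semigroup H L t ρ ∈ statesOn S

/-- `S` is attractive: the distance of `𝒯 t ρ` to `statesOn S` tends to `0` for every state `ρ`.
The distance takes values in `[0, ∞]`, so that the distance to an empty set is `∞`. -/
def IsAttractive (H : E →L[ℂ] E) (L : Fin p → E →L[ℂ] E) (S : Submodule ℂ E) : Prop :=
  ∀ ρ ∈ densityOperators E,
    Filter.Tendsto (fun t : ℝ => Metric.infEDist (semigroup H L t ρ) (statesOn S))
      Filter.atTop (𝓝 0)

/-- `S` is globally asymptotically stable: invariant and attractive. -/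
def IsGAS (H : E →L[ℂ] E) (L : Fin p → E →L[ℂ] E) (S : Submodule ℂ E) : Prop :=
  IsInvariant H L S ∧ IsAttractive H L S

/-- The block of the operator `X` that maps `W` to `V`. For `E = S ⊕ R` (orthogonal) the blocks
of `X` are `X_S = block S S X`, `X_P = block S R X`, `X_Q = block R S X`, `X_R = block R R X`. -/
def block (V W : Submodule ℂ E) (X : E →L[ℂ] E) : W →L[ℂ] V :=
  V.orthogonalProjectionOnto ∘L X ∘L W.subtypeL

/-- The subspace `⋂ k, ker L_{P,k}` of `R` (all of `R` if there are no noise operators). -/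
def noiseKernel (L : Fin p → E →L[ℂ] E) (S R : Submodule ℂ E) : Submodule ℂ E :=
  (⨅ k, LinearMap.ker (block S R (L k) : R →ₗ[ℂ] S)).map R.subtype

/-- The operator `-i H_P - ½ ∑ k, L_{Q,k}† L_{R,k}` from `R` to `S`. -/
def tildeLP (H : E →L[ℂ] E) (L : Fin p → E →L[ℂ] E) (S R : Submodule ℂ E) : R →L[ℂ] S :=
  -(Complex.I • block S R H)
    - (1 / 2 : ℂ) • ∑ k, (block R S (L k)).adjoint ∘L block R R (L k)

/-- The kernel of `tildeLP`, as a subspace of `E` contained in `R`. -/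
def tildeKernel (H : E →L[ℂ] E) (L : Fin p → E →L[ℂ] E) (S R : Submodule ℂ E) :
    Submodule ℂ E :=
  (LinearMap.ker (tildeLP H L S R : R →ₗ[ℂ] S)).map R.subtype

variable (E) in
/-- A state of the algorithm: about to perform the next iteration with the current subspaces
`S = H_S^(j)`, `R = H_R^(j)` and the list `T = [H_T^(1), …, H_T^(j)]` found so far;
successfully completed, with the final list `[H_T^(1), …, H_T^(q)]`; or stopped without
success. -/
inductive State where
  | running (S R : Submodule ℂ E) (T : List (Submodule ℂ E)) : State
  | completed (T : List (Submodule ℂ E)) : State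
  | failed : State

/-- One transition of the algorithm from `running S R T` once the basin `R ⊖ R'` has been split
off from `R`: it is added to `S`, and `R'` is the new `R`. -/
def split (S R R' : Submodule ℂ E) (T : List (Submodule ℂ E)) : State E :=
  .running (S ⊔ (R ⊓ R'ᗮ)) R' (T ++ [R ⊓ R'ᗮ])

open Classical in
/-- One iteration of the dissipation-induced decomposition algorithm. A state in which the
algorithm has stopped is left unchanged. -/
def step (H : E →L[ℂ] E) (L : Fin p → E →L[ℂ] E) : State E → State E
  | .running S R T =>
      if noiseKernel L S R = ⊥ then
        .completed (T ++ [R])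
      else if noiseKernel L S R < R then
        split S R (noiseKernel L S R) T
      else if tildeLP H L S R ≠ 0 then
        if tildeKernel H L S R = ⊥ then
          .completed (T ++ [R])
        else
          split S R (tildeKernel H L S R) T
      else
        .failed
  | .completed T => .completed T
  | .failed => .failed

/-- The state of the algorithm with target `S` after `N` iterations. -/
def run (H : E →L[ℂ] E) (L : Fin p → E →L[ℂ] E) (S : Submodule ℂ E) (N : ℕ) : State E :=
  (step H L)^[N] (.running S Sᗮ [])

/-- The algorithm with target `S` is successfully completed after finitely many iterations,
with output `T = [H_T^(1), …, H_T^(q)]`. -/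
def Completes (H : E →L[ℂ] E) (L : Fin p → E →L[ℂ] E) (S : Submodule ℂ E)
    (T : List (Submodule ℂ E)) : Prop :=
  ∃ N, run H L S N = .completed T

/-- `E` is the orthogonal direct sum of the members of the list `V`. -/
def IsOrthogonalDecomposition (V : List (Submodule ℂ E)) : Prop :=
  OrthogonalFamily ℂ (fun i => V.get i) (fun i => (V.get i).subtypeₗᵢ) ∧
    DirectSum.IsInternal V.get

end DID

end

/-! Put `drift` = G = -iH - ½ ∑ L_k†L_k, so the generator is ρ ↦ Gρ + ρG† + ∑ L_kρL_k†. For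
self-adjoint H, a subspace is invariant under the semigroup exactly when G and all L_k preserve it
(`IsInfInvariant`). Both halves of the theorem then reduce to one criterion, `isGAS_iff`: an
invariant S is GAS if and only if Sᗮ contains no nonzero invariant subspace.

A state inside an invariant W ≤ Sᗮ never approaches S. Conversely, the weight of a trajectory on Sᗮ
decreases to some c. A limit point σ of the trajectory keeps weight c forever, so its block on Sᗮ
evolves without leaking into S. The ranges along that evolution span an invariant subspace of Sᗮ,
which must be zero, whence c = 0. Compactness of the state space turns vanishing weight into
vanishing distance.

The algorithm searches for such a subspace. An invariant W ≤ Sᗮ lies in both kernels that the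
iteration may keep, so the current R always contains every invariant subspace orthogonal to the
target. Success means that none but zero is left; failure means that R itself is invariant and
nonzero. Each iteration that continues shrinks R strictly, so the algorithm stops. The enlarged
S^(j) need not be invariant, and the argument never asks it to be. -/

noncomputable section

set_option linter.unusedSectionVars false
set_option maxSynthPendingDepth 3

namespace DID

open ContinuousLinearMap

/-! ### Euler's formula for the exponential in a Banach algebra -/

section Banach

variable {A : Type*} [NormedRing A]

/-- The assumption `‖1‖ ≤ 1` replaces `‖1‖ = 1`, which fails for operators on the zero space. -/
lemma norm_pow_le_of_norm_one_le (h1 : ‖(1 : A)‖ ≤ 1) {a : A} {M : ℝ} (ha : ‖a‖ ≤ M) (n : ℕ) :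
    ‖a ^ n‖ ≤ M ^ n := by
  induction n with
  | zero => simpa using h1
  | succ n ih =>
    rw [pow_succ, pow_succ]
    exact (norm_mul_le _ _).trans
      (mul_le_mul ih ha (norm_nonneg _) (pow_nonneg ((norm_nonneg _).trans ha) n))

lemma norm_pow_sub_pow_le (h1 : ‖(1 : A)‖ ≤ 1) {a b : A} {M : ℝ} (hM : 1 ≤ M)
    (ha : ‖a‖ ≤ M) (hb : ‖b‖ ≤ M) (n : ℕ) :
    ‖a ^ n - b ^ n‖ ≤ n * M ^ n * ‖a - b‖ := by
  induction n with
  | zero => simp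
  | succ n ih =>
    have hM0 : (0 : ℝ) ≤ M := zero_le_one.trans hM
    have e : a ^ (n + 1) - b ^ (n + 1) = a ^ n * (a - b) + (a ^ n - b ^ n) * b := by
      rw [pow_succ, pow_succ]; noncomm_ring
    have h2 : ‖a ^ n * (a - b)‖ ≤ M ^ (n + 1) * ‖a - b‖ := by
      refine (norm_mul_le _ _).trans (mul_le_mul_of_nonneg_right ?_ (norm_nonneg _))
      exact (norm_pow_le_of_norm_one_le h1 ha n).trans (pow_le_pow_right₀ hM n.le_succ)
    have h3 : ‖(a ^ n - b ^ n) * b‖ ≤ n * M ^ n * ‖a - b‖ * M :=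
      (norm_mul_le _ _).trans (mul_le_mul ih hb (norm_nonneg _) (by positivity))
    rw [e]
    refine (norm_add_le _ _).trans ((add_le_add h2 h3).trans (le_of_eq ?_))
    push_cast; ring

/-- Two curves through `1` with the same velocity there have asymptotically equal powers
`f (1 / n) ^ n`. -/
lemma tendsto_pow_sub_pow_of_hasDerivAt [NormedAlgebra ℝ A] (h1 : ‖(1 : A)‖ ≤ 1) {f g : ℝ → A}
    {x : A} (hf0 : f 0 = 1) (hg0 : g 0 = 1) (hf : HasDerivAt f x 0) (hg : HasDerivAt g x 0) :
    Filter.Tendsto (fun n : ℕ => f (1 / (n + 1 : ℝ)) ^ (n + 1) - g (1 / (n + 1 : ℝ)) ^ (n + 1))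
      Filter.atTop (𝓝 0) := by
  have hs : Filter.Tendsto (fun n : ℕ => 1 / (n + 1 : ℝ)) Filter.atTop (𝓝[≠] 0) :=
    tendsto_nhdsWithin_iff.2 ⟨tendsto_one_div_add_atTop_nhds_zero_nat,
      Filter.Eventually.of_forall fun n => by
        simp only [Set.mem_compl_iff, Set.mem_singleton_iff]; positivity⟩
  have key : ∀ {h : ℝ → A} {y : A}, HasDerivAt h y 0 →
      Filter.Tendsto (fun n : ℕ => (n + 1 : ℝ) • (h (1 / (n + 1 : ℝ)) - h 0))
        Filter.atTop (𝓝 y) := by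
    intro h y hh
    have := (hasDerivAt_iff_tendsto_slope_zero.1 hh).comp hs
    refine this.congr fun n => ?_
    simp
  -- The extra 1 is slack for the convergence of the difference quotients; this bound keeps the `n +
  -- 1`-st powers below `exp (‖x‖ + 1)`.
  have bound : ∀ {h : ℝ → A}, h 0 = 1 → HasDerivAt h x 0 →
      ∀ᶠ n : ℕ in Filter.atTop, ‖h (1 / (n + 1 : ℝ))‖ ≤ 1 + (‖x‖ + 1) / (n + 1 : ℝ) := by
    intro h h0 hh
    filter_upwards [(key hh).norm.eventually (gt_mem_nhds (lt_add_one ‖x‖))] with n hn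
    have hn1 : (0 : ℝ) < n + 1 := by positivity
    rw [h0, norm_smul, Real.norm_of_nonneg hn1.le] at hn
    have : ‖h (1 / (n + 1 : ℝ)) - 1‖ ≤ (‖x‖ + 1) / (n + 1 : ℝ) := by
      rw [le_div_iff₀ hn1]; linarith
    calc ‖h (1 / (n + 1 : ℝ))‖ = ‖1 + (h (1 / (n + 1 : ℝ)) - 1)‖ := by congr 1; abel
      _ ≤ ‖(1 : A)‖ + ‖h (1 / (n + 1 : ℝ)) - 1‖ := norm_add_le _ _
      _ ≤ _ := add_le_add h1 this
  -- `f - g` has derivative zero at 0, so it is `o(1 / n)` there, which beats the factor `n + 1`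
  -- from the telescoped powers.
  have hd : Filter.Tendsto
      (fun n : ℕ => Real.exp (‖x‖ + 1) *
        ‖(n + 1 : ℝ) • ((f - g) (1 / (n + 1 : ℝ)) - (f - g) 0)‖) Filter.atTop (𝓝 0) := by
    have := ((key (hf.sub hg)).norm).const_mul (Real.exp (‖x‖ + 1))
    simpa using this
  refine squeeze_zero_norm' ?_ hd
  filter_upwards [bound hf0 hf, bound hg0 hg] with n hfn hgn
  have hn1 : (0 : ℝ) < n + 1 := by positivity
  refine (norm_pow_sub_pow_le h1 (le_add_of_nonneg_right (by positivity)) hfn hgn (n + 1)).trans ?_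
  have hexp : (1 + (‖x‖ + 1) / (n + 1 : ℝ)) ^ (n + 1) ≤ Real.exp (‖x‖ + 1) := by
    calc _ ≤ Real.exp ((‖x‖ + 1) / (n + 1 : ℝ)) ^ (n + 1) := by
          refine pow_le_pow_left₀ (by positivity) ?_ _
          rw [add_comm]; exact Real.add_one_le_exp _
      _ = _ := by
          rw [← Real.exp_nat_mul]; congr 1; push_cast; field_simp
  rw [norm_smul, Real.norm_of_nonneg hn1.le]
  simp only [Pi.sub_apply, hf0, hg0, sub_self, sub_zero]
  push_cast
  calc _ = (1 + (‖x‖ + 1) / (n + 1 : ℝ)) ^ (n + 1) *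
        ((n + 1 : ℝ) * ‖f (1 / (n + 1 : ℝ)) - g (1 / (n + 1 : ℝ))‖) := by ring
    _ ≤ _ := mul_le_mul_of_nonneg_right hexp (by positivity)

/-- **Euler's formula**: `f (1 / n) ^ n` tends to `exp x` when `f 0 = 1` and `f' 0 = x`. -/
lemma tendsto_pow_exp_of_hasDerivAt [NormedAlgebra ℝ A] [CompleteSpace A]
    (h1 : ‖(1 : A)‖ ≤ 1) {f : ℝ → A} {x : A} (hf0 : f 0 = 1) (hf : HasDerivAt f x 0) :
    Filter.Tendsto (fun n : ℕ => f (1 / (n + 1 : ℝ)) ^ (n + 1))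
      Filter.atTop (𝓝 (NormedSpace.exp x)) := by
  let _ : NormedAlgebra ℚ A := NormedAlgebra.restrictScalars ℚ ℝ A
  -- The comparison curve `s ↦ exp (s x)` has powers equal to `exp x` exactly.
  have hg : HasDerivAt (fun s : ℝ => NormedSpace.exp (s • x)) x 0 := by
    simpa using hasDerivAt_exp_smul_const (𝕂 := ℝ) x (0 : ℝ)
  have h := tendsto_pow_sub_pow_of_hasDerivAt h1 hf0 (by simp) hf hg
  have h' := h.add_const (NormedSpace.exp x)
  rw [zero_add] at h'
  refine h'.congr fun n => ?_
  have hn1 : (n + 1 : ℝ) ≠ 0 := by positivity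
  have : NormedSpace.exp ((1 / (n + 1 : ℝ)) • x) ^ (n + 1) = NormedSpace.exp x := by
    rw [← NormedSpace.exp_nsmul, ← Nat.cast_smul_eq_nsmul ℝ, smul_smul]
    push_cast
    rw [mul_one_div_cancel hn1, one_smul]
  rw [this]; abel

end Banach

variable {E : Type*} [NormedAddCommGroup E] [InnerProductSpace ℂ E] [CompleteSpace E]
  [FiniteDimensional ℂ E] {p : ℕ}

/-! ### Positive operators, trace and support -/

section Positive

lemma isClosed_isPositive : IsClosed {ρ : E →L[ℂ] E | ρ.IsPositive} := by
  simp only [isPositive_iff_complex, Set.ofPred_forall, Set.ofPred_and]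
  refine isClosed_iInter fun x => IsClosed.inter ?_ ?_
  · exact isClosed_eq (by fun_prop) (by fun_prop)
  · exact isClosed_le (by fun_prop) (by fun_prop)

/-- Writing B = C†C, the inner product is ‖Cx‖². -/
lemma apply_eq_zero_of_inner_eq_zero {B : E →L[ℂ] E} (hB : B.IsPositive) {x : E}
    (hx : inner ℂ x (B x) = 0) : B x = 0 := by
  obtain ⟨C, rfl⟩ := CStarAlgebra.nonneg_iff_eq_star_mul_self.1
    ((nonneg_iff_isPositive B).2 hB)
  rw [mul_apply_eq_comp, star_eq_adjoint, adjoint_inner_right, inner_self_eq_zero] at hx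
  rw [mul_apply_eq_comp, hx, map_zero]

variable (E) in
/-- The trace, as a continuous linear functional on the operators. -/
def trC : (E →L[ℂ] E) →L[ℂ] ℂ :=
  LinearMap.toContinuousLinearMap
    ((LinearMap.trace ℂ E).comp (ContinuousLinearMap.coeLM ℂ))

lemma trC_apply (ρ : E →L[ℂ] E) : trC E ρ = LinearMap.trace ℂ E (ρ : E →ₗ[ℂ] E) := rfl

lemma trC_mul_comm (ρ σ : E →L[ℂ] E) : trC E (ρ * σ) = trC E (σ * ρ) :=
  LinearMap.trace_mul_comm ℂ (ρ : E →ₗ[ℂ] E) (σ : E →ₗ[ℂ] E)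

lemma trC_nonneg {ρ : E →L[ℂ] E} (h : ρ.IsPositive) : 0 ≤ (trC E ρ).re :=
  (Complex.nonneg_iff.1 (LinearMap.IsPositive.trace_nonneg
    ((isPositive_toLinearMap_iff ρ).2 h))).1

lemma trC_im {ρ : E →L[ℂ] E} (h : ρ.IsPositive) : (trC E ρ).im = 0 :=
  (Complex.nonneg_iff.1 (LinearMap.IsPositive.trace_nonneg
    ((isPositive_toLinearMap_iff ρ).2 h))).2.symm

lemma eq_zero_of_trC_eq_zero {ρ : E →L[ℂ] E} (h : ρ.IsPositive) (h0 : (trC E ρ).re = 0) :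
    ρ = 0 := by
  let b := stdOrthonormalBasis ℂ E
  rw [trC_apply, LinearMap.trace_eq_sum_inner _ b, Complex.re_sum] at h0
  replace h0 := (Finset.sum_eq_zero_iff_of_nonneg fun i _ => h.re_inner_nonneg_right (b i)).1 h0
  have hz : ∀ i, ρ (b i) = 0 := fun i => by
    refine apply_eq_zero_of_inner_eq_zero h (Complex.ext (h0 i (Finset.mem_univ i)) ?_)
    exact (Complex.nonneg_iff.1 (h.inner_nonneg_right (b i))).2.symm
  ext x
  rw [← b.sum_repr x]
  simp [hz]

lemma trC_conj (C ρ : E →L[ℂ] E) : trC E (C * ρ * star C) = trC E (star C * C * ρ) := by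
  rw [trC_mul_comm, mul_assoc]

lemma isPositive_conj {ρ : E →L[ℂ] E} (h : ρ.IsPositive) (C : E →L[ℂ] E) :
    (C * ρ * star C).IsPositive := h.conj_adjoint C

lemma star_proj (W : Submodule ℂ E) : star W.starProjection = W.starProjection :=
  isSelfAdjoint_starProjection W

lemma proj_mul_self (W : Submodule ℂ E) :
    W.starProjection * W.starProjection = W.starProjection :=
  W.isIdempotentElem_starProjection

lemma proj_orthogonal (W : Submodule ℂ E) : Wᗮ.starProjection = 1 - W.starProjection :=
  W.starProjection_orthogonal

lemma isPositive_proj (W : Submodule ℂ E) : W.starProjection.IsPositive :=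
  .of_isStarProjection isStarProjection_starProjection

lemma proj_conj_isPositive (W : Submodule ℂ E) {ρ : E →L[ℂ] E} (h : ρ.IsPositive) :
    (W.starProjection * ρ * W.starProjection).IsPositive := by
  simpa only [star_proj] using isPositive_conj h W.starProjection

lemma trC_proj_conj (W : Submodule ℂ E) (ρ : E →L[ℂ] E) :
    trC E (W.starProjection * ρ * W.starProjection) = trC E (W.starProjection * ρ) := by
  rw [trC_mul_comm, ← mul_assoc, proj_mul_self]

lemma trC_proj_mul_nonneg (W : Submodule ℂ E) {ρ : E →L[ℂ] E} (h : ρ.IsPositive) :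
    0 ≤ (trC E (W.starProjection * ρ)).re := by
  rw [← trC_proj_conj]; exact trC_nonneg (proj_conj_isPositive W h)

lemma range_le_iff (W : Submodule ℂ E) (ρ : E →L[ℂ] E) :
    (∀ x, ρ x ∈ W) ↔ W.starProjection * ρ = ρ := by
  simp only [ContinuousLinearMap.ext_iff, mul_apply_eq_comp, Submodule.starProjection_eq_self_iff]

/-- A positive operator of zero weight on `Wᗮ` has range in `W`. -/
lemma range_le_of_trC_eq_zero (W : Submodule ℂ E) {ρ : E →L[ℂ] E} (h : ρ.IsPositive)
    (h0 : (trC E (Wᗮ.starProjection * ρ)).re = 0) (x : E) : ρ x ∈ W := by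
  -- The block of ρ on `Wᗮ` is positive of trace zero, hence zero. So ρ kills `Wᗮ`, and by symmetry
  -- its range is orthogonal to `Wᗮ`.
  have hz := eq_zero_of_trC_eq_zero (proj_conj_isPositive Wᗮ h) (by rw [trC_proj_conj, h0])
  have hzv : ∀ v ∈ Wᗮ, ρ v = 0 := fun v hv => by
    refine apply_eq_zero_of_inner_eq_zero h ?_
    have := congrArg (fun T : E →L[ℂ] E => inner ℂ v (T v)) hz
    simpa only [mul_apply_eq_comp, zero_apply, inner_zero_right,
      ← Submodule.inner_starProjection_left_eq_right,
      Submodule.starProjection_eq_self_iff.2 hv] using this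
  rw [← W.orthogonal_orthogonal, Submodule.mem_orthogonal]
  intro v hv
  rw [← h.inner_left_eq_inner_right, hzv v hv, inner_zero_left]

lemma apply_eq_zero_of_mem_orthogonal {W : Submodule ℂ E} {ρ : E →L[ℂ] E} (h : ρ.IsPositive)
    (hW : ∀ x, ρ x ∈ W) {v : E} (hv : v ∈ Wᗮ) : ρ v = 0 := by
  refine ext_inner_right ℂ fun x => ?_
  rw [h.inner_left_eq_inner_right, inner_zero_left]
  exact W.inner_left_of_mem_orthogonal (hW x) hv

lemma mem_statesOn_iff {W : Submodule ℂ E} {ρ : E →L[ℂ] E} :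
    ρ ∈ statesOn W ↔ ρ.IsPositive ∧ trC E ρ = 1 ∧ ∀ x, ρ x ∈ W := by
  rw [statesOn, Set.mem_ofPred_eq, densityOperators, Set.mem_ofPred_eq, and_assoc, ← trC_apply]
  refine and_congr_right fun h => and_congr_right fun _ => ?_
  rw [range_le_iff]
  constructor
  · intro h1; rw [← h1, ← mul_assoc, ← mul_assoc, proj_mul_self]
  · intro h1
    have h2 := congrArg star h1
    rw [star_mul, star_proj, h.isSelfAdjoint.star_eq] at h2
    rw [h1, h2]

/-- The normalized projection onto a nonzero subspace is a state. -/
lemma exists_state_range_eq {W : Submodule ℂ E} (hW : W ≠ ⊥) :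
    ∃ ρ ∈ statesOn W, ∀ w ∈ W, ∃ x, ρ x = w := by
  have hpos : 0 < (trC E W.starProjection).re := by
    refine lt_of_le_of_ne (trC_nonneg (isPositive_proj W)) fun h => hW ?_
    have h0 := eq_zero_of_trC_eq_zero (isPositive_proj W) h.symm
    refine (Submodule.eq_bot_iff W).2 fun x hx => ?_
    rw [← Submodule.starProjection_eq_self_iff.2 hx, h0, zero_apply]
  set c : ℝ := (trC E W.starProjection).re
  have hc : trC E W.starProjection = c := Complex.ext rfl (by simp [trC_im (isPositive_proj W)])
  have hc0 : (c : ℂ) ≠ 0 := by exact_mod_cast hpos.ne'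
  refine ⟨(c : ℂ)⁻¹ • W.starProjection, mem_statesOn_iff.2 ⟨?_, ?_, ?_⟩,
    fun w hw => ⟨(c : ℂ) • w, ?_⟩⟩
  · refine (isPositive_proj W).smul_of_nonneg ?_
    rw [← Complex.ofReal_inv]
    exact Complex.zero_le_real.2 (inv_nonneg.2 hpos.le)
  · rw [map_smul, hc, smul_eq_mul, inv_mul_cancel₀ hc0]
  · intro x; exact W.smul_mem _ (W.starProjection_apply_mem x)
  · rw [smul_apply, map_smul, Submodule.starProjection_eq_self_iff.2 hw, smul_smul,
      inv_mul_cancel₀ hc0, one_smul]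

/-- On the positive operators the norm is bounded by a multiple of the trace. -/
lemma exists_norm_le_trC : ∃ C : ℝ, ∀ ρ : E →L[ℂ] E, ρ.IsPositive → ‖ρ‖ ≤ C * (trC E ρ).re := by
  let K : Set (E →L[ℂ] E) := {ρ | ρ.IsPositive} ∩ Metric.sphere 0 1
  have hK : IsCompact K := (isCompact_sphere _ _).inter_left isClosed_isPositive
  have hcont : Continuous fun ρ : E →L[ℂ] E => (trC E ρ).re := by fun_prop
  have hδ : ∃ δ > 0, ∀ ρ ∈ K, δ ≤ (trC E ρ).re := by
    -- The trace attains a positive minimum on the positive operators of norm one; there are none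
    -- when `E` is zero.
    rcases K.eq_empty_or_nonempty with h | h
    · exact ⟨1, one_pos, by simp [h]⟩
    · obtain ⟨σ, hσ, hmin⟩ := hK.exists_isMinOn h hcont.continuousOn
      refine ⟨_, lt_of_le_of_ne (trC_nonneg hσ.1) fun h0 => ?_, fun ρ hρ => hmin hρ⟩
      have := hσ.2
      rw [eq_zero_of_trC_eq_zero hσ.1 h0.symm] at this
      simp at this
  obtain ⟨δ, hδ, hle⟩ := hδ
  refine ⟨δ⁻¹, fun ρ hρ => ?_⟩
  rcases eq_or_ne ρ 0 with rfl | h0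
  · simp
  have hn : 0 < ‖ρ‖ := norm_pos_iff.2 h0
  have hmem : ((‖ρ‖⁻¹ : ℝ) : ℂ) • ρ ∈ K := by
    refine ⟨hρ.smul_of_nonneg (Complex.zero_le_real.2 (inv_nonneg.2 hn.le)), ?_⟩
    rw [mem_sphere_zero_iff_norm, norm_smul, Complex.norm_real, norm_inv, norm_norm,
      inv_mul_cancel₀ hn.ne']
  have h1 := hle _ hmem
  rw [map_smul, smul_eq_mul, Complex.re_ofReal_mul] at h1
  rw [inv_mul_eq_div, le_div_iff₀ hδ]
  calc ‖ρ‖ * δ ≤ ‖ρ‖ * (‖ρ‖⁻¹ * (trC E ρ).re) := mul_le_mul_of_nonneg_left h1 hn.le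
    _ = _ := by rw [← mul_assoc, mul_inv_cancel₀ hn.ne', one_mul]

lemma isCompact_densityOperators : IsCompact (densityOperators E) := by
  obtain ⟨C, hC⟩ := exists_norm_le_trC (E := E)
  refine Metric.isCompact_of_isClosed_isBounded ?_ ?_
  · exact isClosed_isPositive.inter (isClosed_eq (trC E).continuous continuous_const)
  · refine (Metric.isBounded_closedBall (x := (0 : E →L[ℂ] E)) (r := C)).subset fun ρ hρ => ?_
    have h1 : trC E ρ = 1 := hρ.2
    simpa [h1] using hC ρ hρ.1

end Positive

/-! ### The generator in terms of the drift -/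

section Generator

/-- The effective non-Hermitian drift `-i H - ½ ∑ k, (L k)† (L k)`. -/
def drift (H : E →L[ℂ] E) (L : Fin p → E →L[ℂ] E) : E →L[ℂ] E :=
  -(Complex.I • H) - (1 / 2 : ℂ) • ∑ k, star (L k) * L k

variable {H : E →L[ℂ] E} (hH : IsSelfAdjoint H) (L : Fin p → E →L[ℂ] E)

include hH

lemma star_drift :
    star (drift H L) = Complex.I • H - (1 / 2 : ℂ) • ∑ k, star (L k) * L k := by
  simp [drift, star_sub, star_smul, star_sum, hH.star_eq, star_mul]

lemma sum_star_mul_self : ∑ k, star (L k) * L k = -(drift H L + star (drift H L)) := by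
  rw [star_drift hH, drift]
  module

lemma lindblad_apply (ρ : E →L[ℂ] E) :
    lindblad H L ρ =
      drift H L * ρ + ρ * star (drift H L) + ∑ k, L k * ρ * star (L k) := by
  rw [star_drift hH, drift]
  change -(Complex.I • (H * ρ - ρ * H)) + ∑ k, (L k * ρ * star (L k)
      - (1 / 2 : ℂ) • (star (L k) * L k * ρ + ρ * (star (L k) * L k))) = _
  rw [Finset.sum_sub_distrib, ← Finset.smul_sum, Finset.sum_add_distrib, ← Finset.sum_mul,
    ← Finset.mul_sum]
  simp only [sub_mul, mul_sub, neg_mul, smul_mul_assoc, mul_smul_comm, smul_sub, smul_add]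
  abel

/-- By cyclicity the trace is that of (G + G† + ∑ L_k†L_k)ρ, and the bracket vanishes. -/
lemma trC_lindblad (ρ : E →L[ℂ] E) : trC E (lindblad H L ρ) = 0 := by
  rw [lindblad_apply hH, map_add, map_add, trC_mul_comm ρ, map_sum]
  simp_rw [trC_conj]
  rw [← map_sum, ← Finset.sum_mul, sum_star_mul_self hH, ← map_add, ← map_add, neg_mul, add_mul,
    add_neg_cancel, map_zero]

end Generator

/-! ### The semigroup preserves trace and positivity -/

section Semigroup

variable (H : E →L[ℂ] E) (L : Fin p → E →L[ℂ] E)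

lemma semigroup_zero : semigroup H L 0 = 1 := by
  simp [semigroup]

lemma semigroup_add (s t : ℝ) : semigroup H L (s + t) = semigroup H L s * semigroup H L t := by
  let _ : NormedAlgebra ℚ ((E →L[ℂ] E) →L[ℂ] (E →L[ℂ] E)) := NormedAlgebra.restrictScalars ℚ ℂ _
  rw [semigroup, semigroup, semigroup, ← NormedSpace.exp_add_of_commute, Complex.ofReal_add,
    add_smul]
  exact ((Commute.refl _).smul_left _).smul_right _

lemma hasDerivAt_semigroup (ρ : E →L[ℂ] E) (t : ℝ) :
    HasDerivAt (fun t : ℝ => semigroup H L t ρ) (lindblad H L (semigroup H L t ρ)) t := by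
  have h := (hasDerivAt_exp_smul_const' (𝕂 := ℂ) (lindblad H L) (t : ℂ)).scomp t
    Complex.ofRealCLM.hasDerivAt
  have := ((ContinuousLinearMap.apply ℂ (E →L[ℂ] E) ρ).hasFDerivAt.restrictScalars
    ℝ).comp_hasDerivAt t h
  simpa [Function.comp_def] using! this

/-- The partial sums of the exponential series stay in `V`, which is closed. This serves linear
support conditions, such as the vanishing of a block. -/
lemma semigroup_mem_of_forall_lindblad_mem {V : Submodule ℂ (E →L[ℂ] E)}
    (hV : ∀ ρ ∈ V, lindblad H L ρ ∈ V) {ρ : E →L[ℂ] E} (hρ : ρ ∈ V) (t : ℝ) :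
    semigroup H L t ρ ∈ V := by
  have hs := NormedSpace.exp_series_hasSum_exp' (𝕂 := ℂ) ((t : ℂ) • lindblad H L)
  have hs' := hs.mapL (ContinuousLinearMap.apply ℂ (E →L[ℂ] E) ρ)
  have hpow : ∀ n : ℕ, (((t : ℂ) • lindblad H L) ^ n) ρ ∈ V := fun n => by
    induction n with
    | zero => simpa using hρ
    | succ n ih =>
      rw [pow_succ', mul_apply_eq_comp, smul_apply]
      exact V.smul_mem _ (hV _ ih)
  exact V.closed_of_finiteDimensional.mem_of_tendsto hs'
    (Filter.Eventually.of_forall fun u => V.sum_mem fun n _ => V.smul_mem _ (hpow n))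

variable {H} (hH : IsSelfAdjoint H)

include hH

lemma trC_semigroup (ρ : E →L[ℂ] E) (t : ℝ) : trC E (semigroup H L t ρ) = trC E ρ := by
  have hd : ∀ s : ℝ, HasDerivAt (fun s : ℝ => trC E (semigroup H L s ρ)) 0 s := fun s => by
    have := (trC E).hasFDerivAt.restrictScalars ℝ |>.comp_hasDerivAt s
      (hasDerivAt_semigroup H L ρ s)
    simpa [Function.comp_def, trC_lindblad hH] using this
  have := is_const_of_deriv_eq_zero (fun s => (hd s).differentiableAt) (fun s => (hd s).deriv) t 0
  simpa [semigroup_zero] using this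

/-- The quantum dynamical semigroup preserves positivity. -/
lemma isPositive_semigroup {ρ : E →L[ℂ] E} (hρ : ρ.IsPositive) {t : ℝ} (ht : 0 ≤ t) :
    (semigroup H L t ρ).IsPositive := by
  -- The second-order term `K` completes the square: `f s σ` becomes (1 + stG)σ(1 + stG)† + st ∑
  -- L_kσL_k†, manifestly positive, while the derivative of `f` at 0 is unchanged.
  let K : (E →L[ℂ] E) →L[ℂ] (E →L[ℂ] E) := LinearMap.toContinuousLinearMap
    ((LinearMap.mulLeft ℂ (drift H L)).comp (LinearMap.mulRight ℂ (star (drift H L))))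
  let f : ℝ → (E →L[ℂ] E) →L[ℂ] (E →L[ℂ] E) := fun s =>
    1 + s • ((t : ℂ) • lindblad H L) + (s * s) • (((t * t : ℝ) : ℂ) • K)
  have hf : HasDerivAt f ((t : ℂ) • lindblad H L) 0 := by
    have h1 := ((hasDerivAt_id (0 : ℝ)).smul_const ((t : ℂ) • lindblad H L)).const_add 1
    have h2 := ((hasDerivAt_id (0 : ℝ)).mul (hasDerivAt_id (0 : ℝ))).smul_const
      (((t * t : ℝ) : ℂ) • K)
    simpa [f] using! h1.add h2
  have hlim := tendsto_pow_exp_of_hasDerivAt ContinuousLinearMap.norm_id_le (by simp [f]) hf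
  have hlim' := ((ContinuousLinearMap.apply ℂ (E →L[ℂ] E) ρ).continuous.tendsto _).comp hlim
  have hpos : ∀ s : ℝ, 0 ≤ s → ∀ σ : E →L[ℂ] E, σ.IsPositive → (f s σ).IsPositive := by
    intro s hs σ hσ
    have e : f s σ = (1 + ((s * t : ℝ) : ℂ) • drift H L) * σ *
        star (1 + ((s * t : ℝ) : ℂ) • drift H L) +
        ((s * t : ℝ) : ℂ) • ∑ k, L k * σ * star (L k) := by
      have hK : K σ = drift H L * (σ * star (drift H L)) := rfl
      simp only [f, add_apply, one_apply_eq_self, smul_apply, lindblad_apply hH, hK, star_add, star_one,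
        star_smul, add_mul, mul_add, one_mul, mul_one, smul_mul_assoc, mul_smul_comm, mul_assoc,
        RCLike.star_def, Complex.conj_ofReal, ← Complex.coe_smul, smul_smul]
      push_cast
      module
    rw [e]
    refine (isPositive_conj hσ _).add (IsPositive.smul_of_nonneg ?_ ?_)
    · exact isPositive_sum _ fun k _ => isPositive_conj hσ (L k)
    · exact Complex.zero_le_real.2 (mul_nonneg hs ht)
  refine isClosed_isPositive.mem_of_tendsto hlim' (Filter.Eventually.of_forall fun n => ?_)
  have hn : (0 : ℝ) ≤ 1 / (n + 1 : ℝ) := by positivity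
  have hpow : ∀ m : ℕ, ((f (1 / (n + 1 : ℝ)) ^ m) ρ).IsPositive := fun m => by
    induction m with
    | zero => simpa using hρ
    | succ m ih =>
      rw [pow_succ', mul_apply_eq_comp]
      exact hpos _ hn _ ih
  exact hpow (n + 1)

lemma semigroup_mem_densityOperators {ρ : E →L[ℂ] E} (hρ : ρ ∈ densityOperators E) {t : ℝ}
    (ht : 0 ≤ t) : semigroup H L t ρ ∈ densityOperators E :=
  ⟨isPositive_semigroup L hH hρ.1 ht, (trC_semigroup L hH ρ t).trans hρ.2⟩

end Semigroup

/-! ### Invariant subspaces in terms of noise operators and drift -/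

section Invariance

/-- `W` is invariant under every noise operator and under the drift. -/
def IsInfInvariant (H : E →L[ℂ] E) (L : Fin p → E →L[ℂ] E) (W : Submodule ℂ E) : Prop :=
  (∀ k, ∀ w ∈ W, L k w ∈ W) ∧ ∀ w ∈ W, drift H L w ∈ W

lemma proj_mul_mul_proj {X : E →L[ℂ] E} {W : Submodule ℂ E} (h : ∀ w ∈ W, X w ∈ W) :
    W.starProjection * X * W.starProjection = X * W.starProjection := by
  rw [mul_assoc, ← range_le_iff]
  exact fun x => h _ (W.starProjection_apply_mem x)

lemma proj_mul_star_mul_proj {X : E →L[ℂ] E} {W : Submodule ℂ E} (h : ∀ w ∈ W, X w ∈ W) :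
    W.starProjection * star X * W.starProjection = W.starProjection * star X := by
  have := congrArg star (proj_mul_mul_proj h)
  simpa only [star_mul, star_proj, mul_assoc] using this

variable {H : E →L[ℂ] E} (hH : IsSelfAdjoint H) {L : Fin p → E →L[ℂ] E} {W : Submodule ℂ E}

include hH

/-- A subspace invariant under the noise operators and the drift is invariant for the semigroup. -/
lemma IsInfInvariant.isInvariant (hW : IsInfInvariant H L W) : IsInvariant H L W := by
  intro ρ hρ t ht
  refine ⟨semigroup_mem_densityOperators L hH hρ.1 ht, ?_⟩
  let V : Submodule ℂ (E →L[ℂ] E) :=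
    { carrier := {σ | W.starProjection * σ * W.starProjection = σ}
      add_mem' := fun {a b} ha hb => by
        simp only [Set.mem_ofPred_eq] at ha hb ⊢
        rw [mul_add, add_mul, ha, hb]
      zero_mem' := by simp
      smul_mem' := fun c a ha => by
        simp only [Set.mem_ofPred_eq] at ha ⊢
        rw [mul_smul_comm, smul_mul_assoc, ha] }
  refine semigroup_mem_of_forall_lindblad_mem H L (V := V) (fun σ hσ => ?_) hρ.2 t
  have hσ' : W.starProjection * σ * W.starProjection = σ := hσ
  have hl : W.starProjection * σ = σ := by rw [← hσ', ← mul_assoc, ← mul_assoc, proj_mul_self]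
  have hr : σ * W.starProjection = σ := by rw [← hσ', mul_assoc, proj_mul_self]
  have key : ∀ X : E →L[ℂ] E, (∀ w ∈ W, X w ∈ W) →
      W.starProjection * (X * σ) = X * σ ∧ σ * star X * W.starProjection = σ * star X := by
    intro X hX
    constructor
    · rw [← hl, ← mul_assoc X, ← mul_assoc, ← mul_assoc, proj_mul_mul_proj hX]
    · rw [← hr, mul_assoc σ, mul_assoc σ, proj_mul_star_mul_proj hX]
  change W.starProjection * lindblad H L σ * W.starProjection = lindblad H L σ
  rw [lindblad_apply hH]
  simp only [mul_add, add_mul, Finset.mul_sum, Finset.sum_mul]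
  congr 1
  · congr 1
    · rw [(key _ hW.2).1, mul_assoc, hr]
    · rw [← mul_assoc W.starProjection, hl, (key _ hW.2).2]
  · refine Finset.sum_congr rfl fun k _ => ?_
    rw [← mul_assoc, (key _ (hW.1 k)).1, mul_assoc, mul_assoc, ← mul_assoc σ, (key _ (hW.1 k)).2,
      mul_assoc]

open scoped ComplexOrder in
/-- If a positive operator and its image under the generator both have range in `W`, then the
noise operators and the drift map the range of that operator into `W`. -/
lemma noise_and_drift_mem {B : E →L[ℂ] E} (hB : B.IsPositive) (hBW : ∀ x, B x ∈ W)
    (hLB : ∀ x, lindblad H L B x ∈ W) (x : E) : (∀ k, L k (B x) ∈ W) ∧ drift H L (B x) ∈ W := by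
  have happ : ∀ y, lindblad H L B y = drift H L (B y) + B (star (drift H L) y)
      + ∑ k, L k (B (star (L k) y)) := fun y => by
    rw [lindblad_apply hH]
    simp [mul_apply_eq_comp]
  -- Since Bv = 0, the drift terms drop out of ⟨v, 𝓛(B)v⟩ = 0. What remains is a sum of nonnegative
  -- terms ⟨L_k†v, B L_k†v⟩, each of which must vanish.
  have hvan : ∀ v ∈ Wᗮ, ∀ k, B (star (L k) v) = 0 := by
    intro v hv
    have hBv : B v = 0 := apply_eq_zero_of_mem_orthogonal hB hBW hv
    have h0 : inner ℂ v (lindblad H L B v) = 0 := W.inner_left_of_mem_orthogonal (hLB v) hv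
    rw [happ, hBv, map_zero, zero_add, inner_add_right, ← hB.inner_left_eq_inner_right, hBv,
      inner_zero_left, zero_add, inner_sum] at h0
    have hk : ∀ k, inner ℂ v (L k (B (star (L k) v)))
        = inner ℂ (star (L k) v) (B (star (L k) v)) := fun k => by
      rw [star_eq_adjoint, adjoint_inner_left]
    simp_rw [hk] at h0
    intro k
    exact apply_eq_zero_of_inner_eq_zero hB ((Finset.sum_eq_zero_iff_of_nonneg
      fun k _ => hB.inner_nonneg_right _).1 h0 k (Finset.mem_univ k))
  have hL : ∀ y k, L k (B y) ∈ W := fun y k => by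
    rw [← W.orthogonal_orthogonal, Submodule.mem_orthogonal]
    intro v hv
    rw [← adjoint_inner_left, ← star_eq_adjoint, ← hB.inner_left_eq_inner_right, hvan v hv k,
      inner_zero_left]
  refine ⟨hL x, ?_⟩
  have h1 : drift H L (B x) = lindblad H L B x - B (star (drift H L) x)
      - ∑ k, L k (B (star (L k) x)) := by rw [happ]; abel
  rw [h1]
  exact W.sub_mem (W.sub_mem (hLB x) (hBW _)) (W.sum_mem fun k _ => hL _ k)

omit hH in
/-- The velocity of a trajectory that stays supported in `W` is supported in `W`. -/
lemma lindblad_semigroup_mem {B : E →L[ℂ] E}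
    (h : ∀ t : ℝ, 0 ≤ t → ∀ x, semigroup H L t B x ∈ W) {t : ℝ} (ht : 0 ≤ t) (x : E) :
    lindblad H L (semigroup H L t B) x ∈ W := by
  have h1 : HasDerivAt (fun s : ℝ => semigroup H L s B x) (lindblad H L (semigroup H L t B) x) t := by
    have := ((ContinuousLinearMap.apply ℂ E x).hasFDerivAt.restrictScalars ℝ).comp_hasDerivAt t
      (hasDerivAt_semigroup H L B t)
    simpa [Function.comp_def] using! this
  have h2 : HasDerivAt (fun s : ℝ => W.starProjection (semigroup H L s B x))
      (W.starProjection (lindblad H L (semigroup H L t B) x)) t :=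
    (W.starProjection.hasFDerivAt.restrictScalars ℝ).comp_hasDerivAt t h1
  -- At `t = 0` the trajectory is known to lie in `W` only to the right, hence one-sided
  -- derivatives.
  have h3 : HasDerivWithinAt (fun s : ℝ => semigroup H L s B x)
      (W.starProjection (lindblad H L (semigroup H L t B) x)) (Set.Ici t) t :=
    h2.hasDerivWithinAt.congr
      (fun s hs => (Submodule.starProjection_eq_self_iff.2 (h s (ht.trans hs) x)).symm)
      (Submodule.starProjection_eq_self_iff.2 (h t ht x)).symm
  rw [← Submodule.starProjection_eq_self_iff]
  exact (uniqueDiffWithinAt_Ici t).eq_deriv _ h3 h1.hasDerivWithinAt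

/-- An invariant subspace is invariant under the noise operators and the drift. -/
lemma IsInvariant.isInfInvariant (hW : IsInvariant H L W) : IsInfInvariant H L W := by
  -- The zero subspace supports no state, so its invariance carries no information.
  rcases eq_or_ne W ⊥ with rfl | hne
  · simp [IsInfInvariant]
  obtain ⟨ρ, hρ, hsurj⟩ := exists_state_range_eq hne
  have hmem : ∀ t : ℝ, 0 ≤ t → ∀ x, semigroup H L t ρ x ∈ W := fun t ht =>
    (mem_statesOn_iff.1 (hW ρ hρ t ht)).2.2
  have hd : ∀ x, lindblad H L ρ x ∈ W := fun x => by
    simpa [semigroup_zero] using lindblad_semigroup_mem hmem le_rfl x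
  have hρ' := mem_statesOn_iff.1 hρ
  have key := noise_and_drift_mem hH hρ'.1 hρ'.2.2 hd
  constructor
  · intro k w hw
    obtain ⟨x, rfl⟩ := hsurj w hw
    exact (key x).1 k
  · intro w hw
    obtain ⟨x, rfl⟩ := hsurj w hw
    exact (key x).2

/-- The supports of a positive trajectory span a subspace invariant under the noise operators and
the drift. -/
lemma isInfInvariant_iSup_range {B : E →L[ℂ] E} (hB : B.IsPositive) :
    IsInfInvariant H L (⨆ t : Set.Ici (0 : ℝ), LinearMap.range (semigroup H L t B : E →ₗ[ℂ] E)) := by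
  set W := ⨆ t : Set.Ici (0 : ℝ), LinearMap.range (semigroup H L t B : E →ₗ[ℂ] E)
  have hmem : ∀ t : ℝ, 0 ≤ t → ∀ x, semigroup H L t B x ∈ W := fun t ht x =>
    Submodule.mem_iSup_of_mem (⟨t, ht⟩ : Set.Ici (0 : ℝ)) ⟨x, rfl⟩
  have key : ∀ t : Set.Ici (0 : ℝ), ∀ x, (∀ k, L k (semigroup H L t B x) ∈ W) ∧
      drift H L (semigroup H L t B x) ∈ W := fun t =>
    noise_and_drift_mem hH (isPositive_semigroup L hH hB t.2) (hmem t t.2)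
      (lindblad_semigroup_mem hmem t.2)
  have hle : ∀ X : E →L[ℂ] E,
      (∀ t : Set.Ici (0 : ℝ), ∀ x, X (semigroup H L t B x) ∈ W) → ∀ w ∈ W, X w ∈ W := by
    intro X hX
    have : W ≤ W.comap (X : E →ₗ[ℂ] E) := by
      refine iSup_le fun t => ?_
      rintro _ ⟨x, rfl⟩
      exact hX t x
    exact this
  exact ⟨fun k => hle _ fun t x => (key t x).1 k, hle _ fun t x => (key t x).2⟩

end Invariance

/-! ### The weight outside an invariant subspace -/

section Weight

variable {H : E →L[ℂ] E} (hH : IsSelfAdjoint H) {L : Fin p → E →L[ℂ] E} {S : Submodule ℂ E}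

include hH

/-- The dual generator applied to the projection onto S gives the rate at which S gains weight.
Invariance leaves only its block on `Sᗮ`, which is ∑ L_P†L_P ≥ 0. -/
lemma IsInfInvariant.adjoint_generator_proj (hS : IsInfInvariant H L S) :
    S.starProjection * drift H L + star (drift H L) * S.starProjection
        + ∑ k, star (L k) * S.starProjection * L k
      = ∑ k, Sᗮ.starProjection * (star (L k) * S.starProjection * L k) * Sᗮ.starProjection := by
  set P := S.starProjection with hP
  set G := drift H L
  have hG : P * star G * P = P * star G := proj_mul_star_mul_proj hS.2
  have hG' : P * G * P = G * P := proj_mul_mul_proj hS.2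
  have hk : ∀ k, Sᗮ.starProjection * (star (L k) * P * L k) * Sᗮ.starProjection
      = star (L k) * P * L k - P * (star (L k) * L k) - (star (L k) * L k) * P
        + P * (star (L k) * L k) * P := fun k => by
    have h1 : P * L k * P = L k * P := proj_mul_mul_proj (hS.1 k)
    have h2 : P * star (L k) * P = P * star (L k) := proj_mul_star_mul_proj (hS.1 k)
    have e1 : star (L k) * P * L k * P = star (L k) * L k * P := by
      rw [mul_assoc, mul_assoc, ← mul_assoc P, h1, ← mul_assoc]
    have e2 : P * (star (L k) * P * L k) = P * (star (L k) * L k) := by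
      rw [← mul_assoc, ← mul_assoc, h2, mul_assoc]
    rw [proj_orthogonal, sub_mul, one_mul, e2, mul_sub, mul_one, sub_mul, e1]
    abel
  simp_rw [hk, Finset.sum_add_distrib, Finset.sum_sub_distrib, ← Finset.mul_sum, ← Finset.sum_mul,
    ← Finset.mul_sum, sum_star_mul_self hH]
  change _ = _ - P * -(G + star G) - -(G + star G) * P + P * -(G + star G) * P
  have e3 : P * -(G + star G) * P = -(G * P) - P * star G := by
    rw [mul_neg, neg_mul, mul_add, add_mul, hG, hG']; abel
  rw [e3, mul_neg, mul_add, neg_mul, add_mul]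
  abel

/-- The weight of a positive operator outside an invariant subspace does not increase. -/
lemma IsInfInvariant.trC_proj_lindblad_nonpos (hS : IsInfInvariant H L S) {ρ : E →L[ℂ] E}
    (hρ : ρ.IsPositive) : (trC E (Sᗮ.starProjection * lindblad H L ρ)).re ≤ 0 := by
  have h1 : trC E (S.starProjection * lindblad H L ρ) = trC E
      ((S.starProjection * drift H L + star (drift H L) * S.starProjection
        + ∑ k, star (L k) * S.starProjection * L k) * ρ) := by
    rw [lindblad_apply hH]
    simp only [mul_add, add_mul, Finset.mul_sum, Finset.sum_mul, map_add, map_sum, mul_assoc]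
    congr 1
    · congr 1
      rw [← mul_assoc, trC_mul_comm]
    · refine Finset.sum_congr rfl fun k _ => ?_
      rw [← mul_assoc, ← mul_assoc, trC_mul_comm, mul_assoc]
  rw [proj_orthogonal, sub_mul, one_mul, map_sub, trC_lindblad hH, zero_sub, h1,
    hS.adjoint_generator_proj hH, Finset.sum_mul, map_sum, Complex.neg_re, neg_nonpos,
    Complex.re_sum]
  refine Finset.sum_nonneg fun k _ => ?_
  have h2 := trC_conj (S.starProjection * L k * Sᗮ.starProjection) ρ
  have h3 : star (S.starProjection * L k * Sᗮ.starProjection)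
        * (S.starProjection * L k * Sᗮ.starProjection)
      = Sᗮ.starProjection * (star (L k) * S.starProjection * L k) * Sᗮ.starProjection := by
    rw [star_mul, star_mul, star_proj, star_proj]
    simp only [mul_assoc]
    rw [← mul_assoc S.starProjection S.starProjection, proj_mul_self]
  rw [← h3, ← h2]
  exact trC_nonneg (isPositive_conj hρ _)

lemma IsInfInvariant.antitone_weight (hS : IsInfInvariant H L S) {ρ : E →L[ℂ] E}
    (hρ : ρ.IsPositive) :
    AntitoneOn (fun t : ℝ => (trC E (Sᗮ.starProjection * semigroup H L t ρ)).re) (Set.Ici 0) := by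
  have hd : ∀ t : ℝ, HasDerivAt
      (fun t : ℝ => (trC E (Sᗮ.starProjection * semigroup H L t ρ)).re)
      (trC E (Sᗮ.starProjection * lindblad H L (semigroup H L t ρ))).re t := fun t => by
    let φ : (E →L[ℂ] E) →L[ℂ] ℂ :=
      (trC E).comp (ContinuousLinearMap.mul ℂ (E →L[ℂ] E) Sᗮ.starProjection)
    have h1 := (φ.hasFDerivAt.restrictScalars ℝ).comp_hasDerivAt t (hasDerivAt_semigroup H L ρ t)
    exact (Complex.reCLM.hasFDerivAt.comp_hasDerivAt t h1 :)
  refine antitoneOn_of_deriv_nonpos (convex_Ici 0)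
    (fun t _ => (hd t).continuousAt.continuousWithinAt)
    (fun t _ => (hd t).differentiableAt.differentiableWithinAt) fun t ht => ?_
  rw [interior_Ici] at ht
  rw [(hd t).deriv]
  exact hS.trC_proj_lindblad_nonpos hH (isPositive_semigroup L hH hρ (le_of_lt ht))

/-- The block of `𝒯 t ρ` on `Sᗮ` depends only on the block of `ρ` on `Sᗮ`. -/
lemma IsInfInvariant.semigroup_block_eq_zero (hS : IsInfInvariant H L S) {ρ : E →L[ℂ] E}
    (hρ : Sᗮ.starProjection * ρ * Sᗮ.starProjection = 0) (t : ℝ) :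
    Sᗮ.starProjection * semigroup H L t ρ * Sᗮ.starProjection = 0 := by
  let V : Submodule ℂ (E →L[ℂ] E) :=
    { carrier := {σ | Sᗮ.starProjection * σ * Sᗮ.starProjection = 0}
      add_mem' := fun {a b} ha hb => by
        simp only [Set.mem_ofPred_eq] at ha hb ⊢
        rw [mul_add, add_mul, ha, hb, add_zero]
      zero_mem' := by simp
      smul_mem' := fun c a ha => by
        simp only [Set.mem_ofPred_eq] at ha ⊢
        rw [mul_smul_comm, smul_mul_assoc, ha, smul_zero] }
  refine semigroup_mem_of_forall_lindblad_mem H L (V := V) (fun σ hσ => ?_) hρ t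
  have hσ' : Sᗮ.starProjection * σ * Sᗮ.starProjection = 0 := hσ
  change Sᗮ.starProjection * lindblad H L σ * Sᗮ.starProjection = 0
  set Q := Sᗮ.starProjection with hQ
  -- Preserving `S` means that the block from `S` to `Sᗮ` is zero.
  have hl : ∀ X : E →L[ℂ] E, (∀ w ∈ S, X w ∈ S) → Q * X = Q * X * Q := by
    intro X hX
    have h := proj_mul_mul_proj hX
    rw [hQ, proj_orthogonal, mul_sub, mul_one, sub_mul, sub_mul, one_mul, h, sub_self, sub_zero]
  have hr : ∀ X : E →L[ℂ] E, (∀ w ∈ S, X w ∈ S) → star X * Q = Q * star X * Q := by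
    intro X hX
    have h := proj_mul_star_mul_proj hX
    rw [hQ, proj_orthogonal, sub_mul, one_mul, sub_mul, mul_sub, mul_sub, h, mul_one, mul_one,
      sub_self, sub_zero]
  rw [lindblad_apply hH, mul_add, mul_add, add_mul, add_mul, Finset.mul_sum, Finset.sum_mul]
  have h1 : Q * (drift H L * σ) * Q = 0 := by
    rw [← mul_assoc, hl _ hS.2, mul_assoc, mul_assoc, ← mul_assoc Q σ, hσ', mul_zero]
  have h2 : Q * (σ * star (drift H L)) * Q = 0 := by
    rw [mul_assoc, mul_assoc, hr _ hS.2, ← mul_assoc, ← mul_assoc, ← mul_assoc, hσ', zero_mul,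
      zero_mul]
  have h3 : ∀ k, Q * (L k * σ * star (L k)) * Q = 0 := fun k => by
    have e : Q * (L k * σ * star (L k)) * Q = Q * L k * σ * (star (L k) * Q) := by
      simp only [mul_assoc]
    have e' : Q * L k * Q * σ * (Q * star (L k) * Q) = Q * L k * (Q * σ * Q) * (star (L k) * Q) := by
      simp only [mul_assoc]
    rw [e, hl _ (hS.1 k), hr _ (hS.1 k), e', hσ', mul_zero, zero_mul]
  rw [h1, h2, Finset.sum_eq_zero fun k _ => h3 k, add_zero, add_zero]

end Weight

/-- On the compact set of points of `D` at distance at least ε from `Z`, `g` has a positive lower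
bound, so `u` eventually avoids that set. `Z` may be empty. -/
lemma tendsto_infEDist_of_tendsto_zero {X ι : Type*} [PseudoEMetricSpace X] {D Z : Set X}
    (hD : IsCompact D) {g : X → ℝ} (hg : Continuous g) (hg0 : ∀ x ∈ D, 0 ≤ g x)
    (hZ : ∀ x ∈ D, g x = 0 → x ∈ Z) {l : Filter ι} {u : ι → X} (hu : ∀ᶠ i in l, u i ∈ D)
    (hgu : Filter.Tendsto (fun i => g (u i)) l (𝓝 0)) :
    Filter.Tendsto (fun i => Metric.infEDist (u i) Z) l (𝓝 0) := by
  rw [ENNReal.tendsto_nhds_zero]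
  intro ε hε
  let K : Set X := D ∩ {x | ε ≤ Metric.infEDist x Z}
  have hK : IsCompact K := hD.inter_right (isClosed_le continuous_const Metric.continuous_infEDist)
  have hδ : ∃ δ > 0, ∀ x ∈ K, δ ≤ g x := by
    rcases K.eq_empty_or_nonempty with h | h
    · exact ⟨1, one_pos, by simp [h]⟩
    · obtain ⟨y, hy, hmin⟩ := hK.exists_isMinOn h hg.continuousOn
      refine ⟨g y, lt_of_le_of_ne (hg0 y hy.1) fun h0 => ?_, fun x hx => hmin hx⟩
      have h1 : ε ≤ Metric.infEDist y Z := hy.2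
      rw [Metric.infEDist_zero_of_mem (hZ y hy.1 h0.symm)] at h1
      exact hε.not_ge h1
  obtain ⟨δ, hδ, hle⟩ := hδ
  filter_upwards [hu, hgu.eventually (gt_mem_nhds hδ)] with i hi hgi
  by_contra! hcon
  exact (hle (u i) ⟨hi, hcon.le⟩).not_gt hgi

/-! ### The criterion for global asymptotic stability -/

section Stability

variable {H : E →L[ℂ] E} (hH : IsSelfAdjoint H) {L : Fin p → E →L[ℂ] E} {S : Submodule ℂ E}

lemma continuous_weight (S : Submodule ℂ E) :
    Continuous fun ρ : E →L[ℂ] E => (trC E (S.starProjection * ρ)).re := by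
  fun_prop

include hH

/-- A subspace whose orthogonal complement contains a nonzero invariant subspace is not
attractive. -/
lemma IsAttractive.eq_bot_of_isInfInvariant (hS : IsAttractive H L S) {W : Submodule ℂ E}
    (hW : IsInfInvariant H L W) (hWS : W ≤ Sᗮ) : W = ⊥ := by
  by_contra hne
  obtain ⟨ρ, hρ, -⟩ := exists_state_range_eq hne
  -- The weight on `S` is 1 on `statesOn S` and 0 along a trajectory in `W`, which keeps the two
  -- apart. The bound uses `‖φ‖ + 1` because `φ` vanishes when `S` is zero.
  let φ : (E →L[ℂ] E) →L[ℂ] ℂ :=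
    (trC E).comp (ContinuousLinearMap.mul ℂ (E →L[ℂ] E) S.starProjection)
  have hφ : ∀ σ, φ σ = trC E (S.starProjection * σ) := fun σ => rfl
  have hfar : ∀ t : ℝ, 0 ≤ t →
      ENNReal.ofReal (‖φ‖ + 1)⁻¹ ≤ Metric.infEDist (semigroup H L t ρ) (statesOn S) := by
    intro t ht
    refine Metric.le_infEDist.2 fun τ hτ => ?_
    have hτ' := mem_statesOn_iff.1 hτ
    have hσ' := mem_statesOn_iff.1 (hW.isInvariant hH ρ hρ t ht)
    have h1 : φ τ = 1 := by rw [hφ, (range_le_iff S τ).1 hτ'.2.2, hτ'.2.1]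
    have h2 : φ (semigroup H L t ρ) = 0 := by
      have : S.starProjection * semigroup H L t ρ = 0 := by
        ext x
        exact (S.starProjection_apply_eq_zero_iff).2 (hWS (hσ'.2.2 x))
      rw [hφ, this, map_zero]
    have h3 : 1 ≤ ‖φ‖ * dist (semigroup H L t ρ) τ := by
      have := φ.le_opNorm (semigroup H L t ρ - τ)
      rwa [map_sub, h1, h2, zero_sub, norm_neg, norm_one, ← dist_eq_norm] at this
    rw [edist_dist]
    refine ENNReal.ofReal_le_ofReal ?_
    rw [inv_le_iff_one_le_mul₀ (by positivity)]
    nlinarith [dist_nonneg (x := semigroup H L t ρ) (y := τ)]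
  have hpos : (0 : ENNReal) < ENNReal.ofReal (‖φ‖ + 1)⁻¹ := by
    rw [ENNReal.ofReal_pos]; positivity
  obtain ⟨t, ht, ht0⟩ := (((hS ρ hρ.1).eventually (gt_mem_nhds hpos)).and
    (Filter.eventually_ge_atTop 0)).exists
  exact (hfar t ht0).not_gt ht

/-- An invariant subspace is attractive if its orthogonal complement contains no nonzero invariant
subspace. -/
lemma IsInfInvariant.isAttractive (hS : IsInfInvariant H L S)
    (hno : ∀ W, IsInfInvariant H L W → W ≤ Sᗮ → W = ⊥) : IsAttractive H L S := by
  intro ρ hρ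
  let g : (E →L[ℂ] E) → ℝ := fun σ => (trC E (Sᗮ.starProjection * σ)).re
  have hgc : Continuous g := continuous_weight Sᗮ
  have hmem : ∀ t : ℝ, 0 ≤ t → semigroup H L t ρ ∈ densityOperators E := fun t ht =>
    semigroup_mem_densityOperators L hH hρ ht
  have hg0 : ∀ σ ∈ densityOperators E, 0 ≤ g σ := fun σ hσ => trC_proj_mul_nonneg _ hσ.1
  have hlim : ∃ c, Filter.Tendsto (fun t : ℝ => g (semigroup H L t ρ)) Filter.atTop (𝓝 c) := by
    have hanti : Antitone fun t : ℝ => g (semigroup H L (max t 0) ρ) := fun s t hst =>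
      hS.antitone_weight hH hρ.1 (le_max_right s 0) (le_max_right t 0) (max_le_max_right 0 hst)
    have hbdd : BddBelow (Set.range fun t : ℝ => g (semigroup H L (max t 0) ρ)) := by
      refine ⟨0, ?_⟩
      rintro _ ⟨t, rfl⟩
      exact hg0 _ (hmem _ (le_max_right t 0))
    refine ⟨_, (tendsto_atTop_ciInf hanti hbdd).congr' ?_⟩
    filter_upwards [Filter.eventually_ge_atTop 0] with t ht
    rw [max_eq_left ht]
  obtain ⟨c, hc⟩ := hlim
  -- A limit point σ of the trajectory: its own trajectory consists of limits of `𝒯 (t + ψ n) ρ`, so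
  -- its weight is the constant `c`.
  obtain ⟨σ, hσ, ψ, hψ, hψσ⟩ := isCompact_densityOperators.tendsto_subseq
    fun n : ℕ => hmem n n.cast_nonneg
  have hconst : ∀ t : ℝ, g (semigroup H L t σ) = c := by
    intro t
    have h1 := ((hgc.comp (semigroup H L t).continuous).tendsto σ).comp hψσ
    have h2 : Filter.Tendsto (fun n : ℕ => t + (ψ n : ℝ)) Filter.atTop Filter.atTop :=
      Filter.tendsto_atTop_add_const_left _ _ (tendsto_natCast_atTop_atTop.comp hψ.tendsto_atTop)
    refine tendsto_nhds_unique h1 ((hc.comp h2).congr fun n => ?_)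
    simp only [Function.comp_apply, semigroup_add, mul_apply_eq_comp]
  set Q := Sᗮ.starProjection with hQ
  -- Cutting σ down to its block on `Sᗮ` does not change the weight at any time. The block has trace
  -- `c` as well, so all of its trace stays on `Sᗮ`.
  have hA : (Q * σ * Q).IsPositive := proj_conj_isPositive Sᗮ hσ.1
  have hgA : ∀ t : ℝ, g (semigroup H L t (Q * σ * Q)) = c := by
    intro t
    have hz : Q * (Q * σ * Q - σ) * Q = 0 := by
      have e : Q * (Q * σ * Q) * Q = (Q * Q) * σ * (Q * Q) := by simp only [mul_assoc]
      rw [mul_sub, sub_mul, e, proj_mul_self, sub_self]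
    have h1 := hS.semigroup_block_eq_zero hH hz t
    rw [← hconst t, ← sub_eq_zero]
    simp only [g]
    rw [← Complex.sub_re, ← map_sub, ← mul_sub, ← map_sub, ← trC_proj_conj, h1, map_zero,
      Complex.zero_re]
  have hrange : ∀ t : ℝ, 0 ≤ t → ∀ x, semigroup H L t (Q * σ * Q) x ∈ Sᗮ := by
    intro t ht
    refine range_le_of_trC_eq_zero Sᗮ (isPositive_semigroup L hH hA ht) ?_
    have h1 : (trC E (Q * σ * Q)).re = c := by
      rw [trC_proj_conj, ← hconst 0, semigroup_zero, one_apply_eq_self]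
    rw [proj_orthogonal, sub_mul, one_mul, map_sub, Complex.sub_re, trC_semigroup L hH, h1,
      sub_eq_zero]
    exact (hgA t).symm
  have hbot := hno _ (isInfInvariant_iSup_range hH (L := L) hA) (iSup_le fun t => by
    rintro _ ⟨x, rfl⟩
    exact hrange t t.2 x)
  have hA0 : Q * σ * Q = 0 := by
    ext x
    have h1 : (semigroup H L 0 (Q * σ * Q)) x ∈ (⊥ : Submodule ℂ E) := hbot ▸
      Submodule.mem_iSup_of_mem (⟨0, Set.self_mem_Ici⟩ : Set.Ici (0 : ℝ)) ⟨x, rfl⟩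
    rw [semigroup_zero, one_apply_eq_self] at h1
    exact h1
  have hc0 : c = 0 := by
    rw [← hgA 0, hA0, map_zero]
    simp [g]
  rw [hc0] at hc
  refine tendsto_infEDist_of_tendsto_zero isCompact_densityOperators hgc hg0
    (fun τ hτ hτ0 => ?_) ((Filter.eventually_ge_atTop 0).mono hmem) hc
  exact mem_statesOn_iff.2 ⟨hτ.1, hτ.2, range_le_of_trC_eq_zero S hτ.1 hτ0⟩

/-- An invariant subspace is globally asymptotically stable if and only if its orthogonal complement
contains no nonzero invariant subspace. -/
lemma isGAS_iff (hS : IsInvariant H L S) :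
    IsGAS H L S ↔ ∀ W, IsInfInvariant H L W → W ≤ Sᗮ → W = ⊥ :=
  ⟨fun h _ hW hWS => h.2.eq_bot_of_isInfInvariant hH hW hWS,
    fun h => ⟨hS, (hS.isInfInvariant hH).isAttractive hH h⟩⟩

end Stability

/-! ### The kernels of the algorithm -/

section Blocks

lemma block_apply_eq_zero_iff {V W : Submodule ℂ E} {X : E →L[ℂ] E} (w : W) :
    block V W X w = 0 ↔ X w ∈ Vᗮ :=
  V.orthogonalProjectionOnto_eq_zero_iff

lemma inner_coe_block {V W : Submodule ℂ E} (X : E →L[ℂ] E) (w : W) {v : E} (hv : v ∈ V) :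
    inner ℂ v (block V W X w : E) = inner ℂ v (X w) := by
  change inner ℂ v (V.starProjection (X w)) = _
  rw [← V.inner_starProjection_left_eq_right, Submodule.starProjection_eq_self_iff.2 hv]

lemma mem_noiseKernel_iff {L : Fin p → E →L[ℂ] E} {S R : Submodule ℂ E} {x : E} :
    x ∈ noiseKernel L S R ↔ x ∈ R ∧ ∀ k, L k x ∈ Sᗮ := by
  simp only [noiseKernel, Submodule.mem_map, Submodule.mem_iInf, LinearMap.mem_ker]
  constructor
  · rintro ⟨y, hy, rfl⟩
    exact ⟨y.2, fun k => (block_apply_eq_zero_iff y).1 (hy k)⟩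
  · rintro ⟨hx, hk⟩
    exact ⟨⟨x, hx⟩, fun k => (block_apply_eq_zero_iff ⟨x, hx⟩).2 (hk k), rfl⟩

lemma noiseKernel_le (L : Fin p → E →L[ℂ] E) (S R : Submodule ℂ E) : noiseKernel L S R ≤ R :=
  fun _ hx => (mem_noiseKernel_iff.1 hx).1

lemma mem_tildeKernel_iff {H : E →L[ℂ] E} {L : Fin p → E →L[ℂ] E} {S R : Submodule ℂ E} {x : E} :
    x ∈ tildeKernel H L S R ↔ ∃ hx : x ∈ R, tildeLP H L S R ⟨x, hx⟩ = 0 := by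
  simp [tildeKernel]

lemma tildeKernel_le (H : E →L[ℂ] E) (L : Fin p → E →L[ℂ] E) (S R : Submodule ℂ E) :
    tildeKernel H L S R ≤ R :=
  fun _ hx => (mem_tildeKernel_iff.1 hx).1

lemma tildeKernel_lt {H : E →L[ℂ] E} {L : Fin p → E →L[ℂ] E} {S R : Submodule ℂ E}
    (h : tildeLP H L S R ≠ 0) : tildeKernel H L S R < R := by
  refine lt_of_le_of_ne (tildeKernel_le H L S R) fun he => h ?_
  ext x
  rw [(mem_tildeKernel_iff.1 (he.ge x.2)).2, zero_apply]

/-- When the noise operators map `x ∈ Sᗮ` into `Sᗮ`, the operator `tildeLP` measures the component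
of the drift of `x` along `S`. -/
lemma tildeLP_apply_eq_zero_iff {H : E →L[ℂ] E} {L : Fin p → E →L[ℂ] E} {S : Submodule ℂ E}
    (x : Sᗮ) (hx : ∀ k, L k x ∈ Sᗮ) : tildeLP H L S Sᗮ x = 0 ↔ drift H L x ∈ Sᗮ := by
  have key : ∀ s : S, inner ℂ s (tildeLP H L S Sᗮ x) = inner ℂ (s : E) (drift H L x) := by
    intro s
    -- As L_k x lies in `Sᗮ`, pairing it with L_k s sees only the component L_Q s.
    have hk : ∀ k, inner ℂ s ((block Sᗮ S (L k)).adjoint (block Sᗮ Sᗮ (L k) x))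
        = inner ℂ (s : E) (star (L k) (L k x)) := by
      intro k
      have h1 : (block Sᗮ Sᗮ (L k) x : E) = L k x :=
        Submodule.starProjection_eq_self_iff.2 (hx k)
      rw [adjoint_inner_right, Submodule.coe_inner, h1, ← inner_conj_symm,
        inner_coe_block _ _ (hx k), inner_conj_symm, star_eq_adjoint, adjoint_inner_right]
    have hHs : inner ℂ s (block S Sᗮ H x) = inner ℂ (s : E) (H x) :=
      inner_coe_block H x s.2
    simp only [tildeLP, drift, sub_apply, neg_apply, smul_apply, sum_apply, comp_apply,
      mul_apply_eq_comp, inner_sub_right, inner_neg_right, inner_smul_right, inner_sum, hk, hHs]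
  rw [Submodule.mem_orthogonal]
  constructor
  · intro h s hs
    rw [← key ⟨s, hs⟩, h, inner_zero_right]
  · intro h
    exact ext_inner_left ℂ fun s => by rw [key, h s s.2, inner_zero_right]

variable {H : E →L[ℂ] E} {L : Fin p → E →L[ℂ] E} {S W : Submodule ℂ E}

lemma IsInfInvariant.le_noiseKernel (hW : IsInfInvariant H L W) (hWS : W ≤ Sᗮ) :
    W ≤ noiseKernel L S Sᗮ :=
  fun x hx => mem_noiseKernel_iff.2 ⟨hWS hx, fun k => hWS (hW.1 k x hx)⟩

lemma IsInfInvariant.le_tildeKernel (hW : IsInfInvariant H L W) (hWS : W ≤ Sᗮ) :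
    W ≤ tildeKernel H L S Sᗮ :=
  fun x hx => mem_tildeKernel_iff.2 ⟨hWS hx,
    (tildeLP_apply_eq_zero_iff ⟨x, hWS hx⟩ fun k => hWS (hW.1 k x hx)).2 (hWS (hW.2 x hx))⟩

/-- This is the situation in which the algorithm fails: nothing flows from `Sᗮ` to `S`, through
noise or drift. -/
lemma isInfInvariant_orthogonal (hK : Sᗮ ≤ noiseKernel L S Sᗮ) (hT : tildeLP H L S Sᗮ = 0) :
    IsInfInvariant H L Sᗮ := by
  have h1 : ∀ k, ∀ w ∈ Sᗮ, L k w ∈ Sᗮ := fun k w hw => (mem_noiseKernel_iff.1 (hK hw)).2 k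
  refine ⟨h1, fun w hw => ?_⟩
  refine (tildeLP_apply_eq_zero_iff ⟨w, hw⟩ fun k => h1 k w hw).1 ?_
  rw [hT, zero_apply]

end Blocks

/-! ### Orthogonal lists of subspaces -/

section OrthogonalLists

lemma isOrthogonalDecomposition_of_pairwise {V : List (Submodule ℂ E)}
    (h : V.Pairwise (· ⟂ ·)) (htop : sSup {W | W ∈ V} = ⊤) : IsOrthogonalDecomposition V := by
  have hfam : OrthogonalFamily ℂ (fun i => V.get i) (fun i => (V.get i).subtypeₗᵢ) := by
    refine OrthogonalFamily.of_pairwise fun i j hij => ?_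
    rcases lt_or_gt_of_ne hij with hlt | hlt
    · exact List.pairwise_iff_get.1 h i j hlt
    · exact (List.pairwise_iff_get.1 h j i hlt).symm
  refine ⟨hfam, hfam.isInternal_iff.2 ?_⟩
  rw [Submodule.orthogonal_eq_bot_iff, ← htop, ← sSup_range, Set.range_list_get]

lemma sSup_mem_concat (V : List (Submodule ℂ E)) (D : Submodule ℂ E) :
    sSup {W | W ∈ V ++ [D]} = sSup {W | W ∈ V} ⊔ D := by
  have : {W | W ∈ V ++ [D]} = {W | W ∈ V} ∪ {D} := by
    ext W; simp [or_comm]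
  rw [this, sSup_union, sSup_singleton]

lemma pairwise_isOrtho_concat {V : List (Submodule ℂ E)} {D : Submodule ℂ E}
    (h : V.Pairwise (· ⟂ ·)) (hD : D ≤ (sSup {W | W ∈ V})ᗮ) : (V ++ [D]).Pairwise (· ⟂ ·) := by
  refine List.pairwise_append.2 ⟨h, List.pairwise_singleton _ _, fun W hW D' hD' => ?_⟩
  rw [List.mem_singleton.1 hD']
  exact (Submodule.isOrtho_iff_le.2
    (hD.trans (Submodule.orthogonal_le (le_sSup (a := W) hW)))).symm

lemma orthogonal_sup_inf_orthogonal {S R : Submodule ℂ E} (hR : R ≤ Sᗮ) :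
    (S ⊔ (Sᗮ ⊓ Rᗮ))ᗮ = R := by
  rw [Submodule.sup_orthogonal_inf_of_hasOrthogonalProjection
    (Submodule.le_orthogonal_iff_le_orthogonal.1 hR), Submodule.orthogonal_orthogonal]

end OrthogonalLists

/-! ### Correctness and termination of the algorithm -/

section Algorithm

variable (H : E →L[ℂ] E) (L : Fin p → E →L[ℂ] E)

/-- The loop invariant of the algorithm with target `S₀`. -/
def LoopInvariant (S₀ : Submodule ℂ E) : State E → Prop
  | .running S R T => R = Sᗮ ∧ S₀ ≤ S ∧ sSup {V | V ∈ S₀ :: T} = S ∧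
      (S₀ :: T).Pairwise (· ⟂ ·) ∧ ∀ W, IsInfInvariant H L W → W ≤ S₀ᗮ → W ≤ R
  | .completed T => sSup {V | V ∈ S₀ :: T} = ⊤ ∧ (S₀ :: T).Pairwise (· ⟂ ·) ∧
      ∀ W, IsInfInvariant H L W → W ≤ S₀ᗮ → W = ⊥
  | .failed => ∃ W, IsInfInvariant H L W ∧ W ≤ S₀ᗮ ∧ W ≠ ⊥

variable {H L} {S₀ : Submodule ℂ E}

lemma LoopInvariant.completed {S : Submodule ℂ E} {T : List (Submodule ℂ E)}
    (h : LoopInvariant H L S₀ (.running S Sᗮ T))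
    (hbot : ∀ W, IsInfInvariant H L W → W ≤ Sᗮ → W = ⊥) :
    LoopInvariant H L S₀ (.completed (T ++ [Sᗮ])) := by
  obtain ⟨-, -, hsup, hpw, hinv⟩ := h
  refine ⟨?_, ?_, fun W hW hWS => hbot W hW (hinv W hW hWS)⟩
  · rw [← List.cons_append, sSup_mem_concat, hsup,
      Submodule.sup_orthogonal_of_hasOrthogonalProjection]
  · rw [← List.cons_append]
    exact pairwise_isOrtho_concat hpw (by rw [hsup])

/-- All that matters about the retained `R'` is that no invariant subspace of `Sᗮ` escapes it. -/
lemma LoopInvariant.split {S R' : Submodule ℂ E} {T : List (Submodule ℂ E)}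
    (h : LoopInvariant H L S₀ (.running S Sᗮ T)) (hR' : R' ≤ Sᗮ)
    (hle : ∀ W, IsInfInvariant H L W → W ≤ Sᗮ → W ≤ R') :
    LoopInvariant H L S₀ (split S Sᗮ R' T) := by
  obtain ⟨-, hS, hsup, hpw, hinv⟩ := h
  refine ⟨(orthogonal_sup_inf_orthogonal hR').symm, hS.trans le_sup_left, ?_, ?_,
    fun W hW hWS => hle W hW (hinv W hW hWS)⟩
  · rw [← List.cons_append, sSup_mem_concat, hsup]
  · rw [← List.cons_append]
    exact pairwise_isOrtho_concat hpw (by rw [hsup]; exact inf_le_left)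

lemma LoopInvariant.step {s : State E} (h : LoopInvariant H L S₀ s) :
    LoopInvariant H L S₀ (step H L s) := by
  match s, h with
  | .completed T, h => exact h
  | .failed, h => exact h
  | .running S R T, h =>
    obtain rfl : R = Sᗮ := h.1
    rw [DID.step]
    split_ifs with h1 h2 h3 h4
    · exact h.completed fun W hW hWS => le_bot_iff.1 (h1 ▸ hW.le_noiseKernel hWS)
    · exact h.split h2.le fun W hW hWS => hW.le_noiseKernel hWS
    · exact h.completed fun W hW hWS => le_bot_iff.1 (h4 ▸ hW.le_tildeKernel hWS)
    · exact h.split (tildeKernel_le H L S Sᗮ) fun W hW hWS => hW.le_tildeKernel hWS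
    -- The obstruction is the current `Sᗮ`; were it zero, the first test would already have
    -- succeeded.
    · have hK : Sᗮ ≤ noiseKernel L S Sᗮ :=
        not_lt_iff_le_imp_ge.1 h2 (noiseKernel_le L S Sᗮ)
      refine ⟨Sᗮ, isInfInvariant_orthogonal hK (not_not.1 h3), Submodule.orthogonal_le h.2.1,
        fun hb => h1 ?_⟩
      exact le_bot_iff.1 (hb ▸ noiseKernel_le L S Sᗮ)

variable (H L S₀)

lemma loopInvariant_run (N : ℕ) : LoopInvariant H L S₀ (run H L S₀ N) := by
  induction N with
  | zero => exact ⟨rfl, le_rfl, by simp, List.pairwise_singleton _ _, fun W _ h => h⟩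
  | succ N ih =>
    rw [run, Function.iterate_succ_apply']
    exact ih.step

/-- The strict decrease of `R` drives the well-founded induction for termination. -/
lemma step_running (S R : Submodule ℂ E) (T : List (Submodule ℂ E)) :
    (∃ T', step H L (.running S R T) = .completed T') ∨ step H L (.running S R T) = .failed ∨
      ∃ S' R' T', R' < R ∧ step H L (.running S R T) = .running S' R' T' := by
  rw [step]
  split_ifs with h1 h2 h3 h4
  · exact .inl ⟨_, rfl⟩
  · exact .inr (.inr ⟨_, _, _, h2, rfl⟩)
  · exact .inl ⟨_, rfl⟩
  · exact .inr (.inr ⟨_, _, _, tildeKernel_lt h3, rfl⟩)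
  · exact .inr (.inl rfl)

/-- The algorithm stops after finitely many iterations. -/
lemma exists_iterate_step_halts (S R : Submodule ℂ E) (T : List (Submodule ℂ E)) :
    (∃ N T', (step H L)^[N] (.running S R T) = .completed T') ∨
      ∃ N, (step H L)^[N] (.running S R T) = .failed := by
  induction R using WellFoundedLT.induction generalizing S T with
  | ind R ih =>
    rcases step_running H L S R T with ⟨T', h⟩ | h | ⟨S', R', T', hlt, h⟩
    · exact .inl ⟨1, T', h⟩
    · exact .inr ⟨1, h⟩
    · rcases ih R' hlt S' T' with ⟨N, T'', hN⟩ | ⟨N, hN⟩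
      · exact .inl ⟨N + 1, T'', by rw [Function.iterate_succ_apply, h, hN]⟩
      · exact .inr ⟨N + 1, by rw [Function.iterate_succ_apply, h, hN]⟩

end Algorithm

end DID

end

theorem mainTheorem2 {E : Type*} [NormedAddCommGroup E] [InnerProductSpace ℂ E]
    [CompleteSpace E] [FiniteDimensional ℂ E] {p : ℕ}
    (H : E →L[ℂ] E) (hH : IsSelfAdjoint H) (L : Fin p → E →L[ℂ] E)
    (S : Submodule ℂ E) (hS : DID.IsInvariant H L S) :
    ((∃ T, DID.Completes H L S T) ↔ DID.IsGAS H L S) ∧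
      (∀ T, DID.Completes H L S T → DID.IsOrthogonalDecomposition (S :: T)) ∧
      ((¬ ∃ T, DID.Completes H L S T) → ∃ N, DID.run H L S N = .failed) := by
  have hcompl : ∀ T, DID.Completes H L S T → DID.LoopInvariant H L S (.completed T) := by
    rintro T ⟨N, hN⟩
    exact hN ▸ DID.loopInvariant_run H L S N
  have hfail : (¬ ∃ T, DID.Completes H L S T) → ∃ N, DID.run H L S N = .failed := by
    intro hno
    rcases DID.exists_iterate_step_halts H L S Sᗮ [] with ⟨N, T, h⟩ | h
    · exact absurd ⟨T, N, h⟩ hno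
    · exact h
  refine ⟨?_, fun T hT => ?_, hfail⟩
  · rw [DID.isGAS_iff hH hS]
    refine ⟨fun ⟨T, hT⟩ => (hcompl T hT).2.2, fun hall => ?_⟩
    by_contra hno
    obtain ⟨N, hN⟩ := hfail hno
    obtain ⟨W, hW, hWS, hne⟩ : DID.LoopInvariant H L S .failed :=
      hN ▸ DID.loopInvariant_run H L S N
    exact hne (hall W hW hWS)
  · obtain ⟨hsup, hpw, -⟩ := hcompl T hT
    exact DID.isOrthogonalDecomposition_of_pairwise hpw hsup
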